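/- Let $P(\lambda)=\sum_{j=-k}^{k}A_j\lambda^j$, $A_j\in\mathbb C^{n\times n}$, be a regular ($\det P(\lambda)\not\equiv 0$) Laurent matrix polynomial that is purely palindromic, i.e. $A_j=A_{-j}$ for all $j$. Then there is exactly one matrix polynomial $Q(y)$ with $Q(\lambda+\lambda^{-1})=P(\lambda)$. For a matrix function $F$ analytic near $z_0$, vectors $x_0,\dots,x_{\ell-1}$ with $\ell\ge 1$ and $x_0\neq 0$ form a Jordan chain of length $\ell$ of $F$ at $z_0$ if $\sum_{i=0}^{m}\frac{F^{(m-i)}(z_0)}{(m-i)!}x_i=0$ for $m=0,\dots,\ell-1$. A canonical set of Jordan chains at $z_0$ is a finite sequence of Jordan chains whose leading vectors form a basis of $\ker F(z_0)$, each chain having maximal length among all Jordan chains whose leading vector is not in the span of the leading vectors of the preceding ones. The Jordan structure of $F$ at $z_0$ is the multiset of the lengths of the chains of a canonical set (empty if $z_0$ is not an eigenvalue). For $P$ at every $z_0\neq 0$ and for $Q$ at every $z_0\in\mathbb C$ canonical sets exist and this multiset does not depend on the choice, and the following hold. 1. If $\lambda_0\in\mathbb C\setminus\{0,1,-1\}$,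 then the Jordan structure of $Q$ at $y_0=\lambda_0+\lambda_0^{-1}$ equals the Jordan structure of $P$ at $\lambda_0$, and equals the Jordan structure of $P$ at $\lambda_0^{-1}$. 2. If $\lambda_0=\pm1$ (so $y_0=\pm2$), then for every $\ell\ge1$ there is a Jordan chain of length $\ell$ of $Q$ at $y_0$ if and only if there is a Jordan chain of length $2\ell$ of $P$ at $\lambda_0$. Moreover, the Jordan structure of $P$ at $\lambda_0$ is obtained from the Jordan structure of $Q$ at $y_0$ by doubling every length. -/

import Mathlib

namespace Palindromic

/-- The values of a Laurent matrix polynomial `P(z) = ∑ A_j z ^ j` with coefficients in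
`ℂ^{n × n}`, as a matrix function of `z` (meaningful for `z ≠ 0`). -/
noncomputable def laurentFun {n : ℕ} (P : Matrix (Fin n) (Fin n) (LaurentPolynomial ℂ)) :
    ℂ → Matrix (Fin n) (Fin n) ℂ :=
  fun z => Matrix.of fun a b => (P a b).coeff.sum fun j c => c * z ^ j

/-- The values of a matrix polynomial, as a matrix function. -/
noncomputable def polyFun {n : ℕ} (Q : Matrix (Fin n) (Fin n) (Polynomial ℂ)) :
    ℂ → Matrix (Fin n) (Fin n) ℂ :=
  fun y => Matrix.of fun a b => (Q a b).eval y

/-- The matrix coefficient `A_j` of a Laurent matrix polynomial. -/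
def coeffMatrix {n : ℕ} (P : Matrix (Fin n) (Fin n) (LaurentPolynomial ℂ)) (j : ℤ) :
    Matrix (Fin n) (Fin n) ℂ :=
  Matrix.of fun a b => (P a b).coeff j

/-- `P` is purely palindromic: `A_j = A_{-j}` for all `j`. -/
def IsPurelyPalindromic {n : ℕ} (P : Matrix (Fin n) (Fin n) (LaurentPolynomial ℂ)) : Prop :=
  ∀ j : ℤ, coeffMatrix P j = coeffMatrix P (-j)

/-- `P` is regular: its determinant is not identically zero. -/
def IsRegular {n : ℕ} (P : Matrix (Fin n) (Fin n) (LaurentPolynomial ℂ)) : Prop :=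
  P.det ≠ 0

/-- The matrix polynomial `Q(y)` is obtained from `P(λ)` by the change of variable
`y = λ + 1/λ`: substituting `λ + 1/λ` for `y` in `Q` gives `P`. -/
def IsDicksonTransform {n : ℕ} (P : Matrix (Fin n) (Fin n) (LaurentPolynomial ℂ))
    (Q : Matrix (Fin n) (Fin n) (Polynomial ℂ)) : Prop :=
  Q.map (Polynomial.aeval (LaurentPolynomial.T 1 + LaurentPolynomial.T (-1) :
    LaurentPolynomial ℂ)) = P

/-- The entrywise `k`-th derivative of a matrix function at `z₀`, divided by `k!`. -/
noncomputable def taylorCoeff {n : ℕ} (F : ℂ → Matrix (Fin n) (Fin n) ℂ) (z₀ : ℂ) (k : ℕ) :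
    Matrix (Fin n) (Fin n) ℂ :=
  Matrix.of fun a b => iteratedDeriv k (fun z => F z a b) z₀ / (k.factorial : ℂ)

/-- The vectors `x 0, …, x (ℓ - 1)` form a Jordan chain of length `ℓ` of `F` at `z₀`
(the other values of `x` play no role). A chain need not be maximal. -/
def IsJordanChain {n : ℕ} (F : ℂ → Matrix (Fin n) (Fin n) ℂ) (z₀ : ℂ) (ℓ : ℕ)
    (x : ℕ → Fin n → ℂ) : Prop :=
  1 ≤ ℓ ∧ x 0 ≠ 0 ∧
    ∀ m < ℓ, ∑ i ∈ Finset.range (m + 1), (taylorCoeff F z₀ (m - i)).mulVec (x i) = 0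

/-- A canonical set of Jordan chains of `F` at `z₀`: the leading vectors of the chains form a
basis of `ker F(z₀)`, and each chain in turn has the largest length among all Jordan chains
whose leading vector is not in the span of the leading vectors chosen before it. -/
structure IsCanonicalSet {n : ℕ} (F : ℂ → Matrix (Fin n) (Fin n) ℂ) (z₀ : ℂ) (r : ℕ)
    (κ : Fin r → ℕ) (x : Fin r → ℕ → Fin n → ℂ) : Prop where
  chain : ∀ i, IsJordanChain F z₀ (κ i) (x i)
  linearIndependent : LinearIndependent ℂ fun i => x i 0
  span_eq : Submodule.span ℂ (Set.range fun i => x i 0) = LinearMap.ker (F z₀).mulVecLin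
  maximal : ∀ (i : Fin r) (ℓ : ℕ) (y : ℕ → Fin n → ℂ), IsJordanChain F z₀ ℓ y →
    y 0 ∉ Submodule.span ℂ ((fun j => x j 0) '' {j | j < i}) → ℓ ≤ κ i

/-- `s` is the multiset of the lengths of the chains of a canonical set of Jordan chains. -/
def IsLengthMultiset {n : ℕ} (F : ℂ → Matrix (Fin n) (Fin n) ℂ) (z₀ : ℂ)
    (s : Multiset ℕ) : Prop :=
  ∃ (r : ℕ) (κ : Fin r → ℕ) (x : Fin r → ℕ → Fin n → ℂ),
    IsCanonicalSet F z₀ r κ x ∧ s = Multiset.map κ Finset.univ.val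

/-- The Jordan structure of `F` at `z₀` is well defined and equal to `s`: canonical sets of
Jordan chains exist, and `s` is the multiset of the chain lengths of every one of them. It is
the empty multiset when `z₀` is not an eigenvalue. -/
def HasJordanStructure {n : ℕ} (F : ℂ → Matrix (Fin n) (Fin n) ℂ) (z₀ : ℂ)
    (s : Multiset ℕ) : Prop :=
  ∀ t : Multiset ℕ, IsLengthMultiset F z₀ t ↔ t = s

end Palindromic

open Module
open scoped PowerSeries

namespace Palindromic

/-! ### Jordan structures as dimensions of a filtration of the kernel -/

section CanonicalSets

variable {n : ℕ} {F : ℂ → Matrix (Fin n) (Fin n) ℂ} {z₀ : ℂ}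

/-! Leading vectors of chains of length `m`, together with `0`, form subspaces `V m` decreasing from
the kernel to `0`. In any canonical set exactly `dim V m` chains have length at least `m`
(`IsCanonicalSet.countP_eq_finrank`), so these dimensions determine the Jordan structure.

Near `λ₀`, `λ + λ⁻¹ = y₀ + φ` with `φ = X ^ d * u`, `u` a unit, and `d = 2` exactly at the critical
points `±1`, otherwise `d = 1` (`exists_taylorSeries_add_inv`). A chain of `P` is a power series
vector `w` with `Q(y₀ + φ) w ≡ 0` modulo `X ^ m`. Writing `w ≡ ∑ X ^ i * A_i(φ)`, `i < d`, the
summands of the product have orders in distinct classes modulo `d`, so each vanishes separately, and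
`A_0`, which carries the leading vector, gives a chain of `Q`. Hence `V_P m = V_Q ⌈m / d⌉`
(`mem_leadingSpace_iff`): the structures agree for `d = 1`, and lengths double for `d = 2`. -/

theorem taylorCoeff_zero (F : ℂ → Matrix (Fin n) (Fin n) ℂ) (z₀ : ℂ) :
    taylorCoeff F z₀ 0 = F z₀ := by
  ext a b
  simp [taylorCoeff]

theorem exists_isJordanChain_one_iff {x : Fin n → ℂ} :
    (∃ y, IsJordanChain F z₀ 1 y ∧ y 0 = x) ↔ x ≠ 0 ∧ (F z₀).mulVec x = 0 := by
  constructor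
  · rintro ⟨y, ⟨-, h0, h⟩, rfl⟩
    exact ⟨h0, by simpa [taylorCoeff_zero] using h 0 one_pos⟩
  · rintro ⟨h0, h⟩
    refine ⟨fun _ => x, ⟨le_rfl, h0, fun m hm => ?_⟩, rfl⟩
    obtain rfl : m = 0 := by omega
    simpa [taylorCoeff_zero] using h

/-- `V m` consists of `0` and the leading vectors of the Jordan chains of length `m`. -/
structure IsLeadingFiltration (F : ℂ → Matrix (Fin n) (Fin n) ℂ) (z₀ : ℂ)
    (V : ℕ → Submodule ℂ (Fin n → ℂ)) : Prop where
  antitone : Antitone V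
  exists_chain_iff : ∀ m x,
    (∃ y, IsJordanChain F z₀ m y ∧ y 0 = x) ↔ 1 ≤ m ∧ x ≠ 0 ∧ x ∈ V m
  exists_eq_bot : ∃ N, V N = ⊥

variable {V : ℕ → Submodule ℂ (Fin n → ℂ)}

theorem IsLeadingFiltration.mem_of_isJordanChain (hV : IsLeadingFiltration F z₀ V) {m : ℕ}
    {y : ℕ → Fin n → ℂ} (hy : IsJordanChain F z₀ m y) : y 0 ∈ V m :=
  ((hV.exists_chain_iff m (y 0)).1 ⟨y, hy, rfl⟩).2.2

theorem IsLeadingFiltration.eq_ker (hV : IsLeadingFiltration F z₀ V) :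
    V 1 = LinearMap.ker (F z₀).mulVecLin := by
  ext x
  by_cases hx : x = 0
  · simp [hx]
  · have := (hV.exists_chain_iff 1 x).symm.trans exists_isJordanChain_one_iff
    simpa [hx] using this

/-- A vector of `V m` outside the span would, by maximality and induction on `i`, force every chain
to have length at least `m`; the span would then be the whole kernel, which contains the vector. -/
theorem IsCanonicalSet.filtration_eq_span (hV : IsLeadingFiltration F z₀ V) {r : ℕ}
    {κ : Fin r → ℕ} {x : Fin r → ℕ → Fin n → ℂ} (h : IsCanonicalSet F z₀ r κ x) {m : ℕ}
    (hm : 1 ≤ m) :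
    V m = Submodule.span ℂ (Set.range fun i : {i // m ≤ κ i} => x i 0) := by
  apply le_antisymm
  · intro y hy
    by_contra hyS
    have hy0 : y ≠ 0 := fun h0 => hyS (h0 ▸ Submodule.zero_mem _)
    have key : ∀ i : Fin r, m ≤ κ i := by
      intro i
      induction i using WellFoundedLT.induction with
      | ind i ih =>
        obtain ⟨c, hc, hc0⟩ := (hV.exists_chain_iff m y).2 ⟨hm, hy0, hy⟩
        refine h.maximal i m c hc fun hmem => hyS ?_
        rw [hc0] at hmem
        refine Submodule.span_mono ?_ hmem
        rintro _ ⟨j, hj, rfl⟩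
        exact ⟨⟨j, ih j hj⟩, rfl⟩
    apply hyS
    have : y ∈ Submodule.span ℂ (Set.range fun i => x i 0) := by
      rw [h.span_eq, ← hV.eq_ker]
      exact hV.antitone hm hy
    refine Submodule.span_mono ?_ this
    rintro _ ⟨j, rfl⟩
    exact ⟨⟨j, key j⟩, rfl⟩
  · rw [Submodule.span_le]
    rintro _ ⟨⟨i, hi⟩, rfl⟩
    exact hV.antitone hi (hV.mem_of_isJordanChain (h.chain i))

theorem IsCanonicalSet.countP_eq_finrank (hV : IsLeadingFiltration F z₀ V) {r : ℕ}
    {κ : Fin r → ℕ} {x : Fin r → ℕ → Fin n → ℂ} (h : IsCanonicalSet F z₀ r κ x) {m : ℕ}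
    (hm : 1 ≤ m) :
    (Multiset.map κ Finset.univ.val).countP (m ≤ ·) = finrank ℂ (V m) := by
  rw [h.filtration_eq_span hV hm, finrank_span_eq_card
    (b := fun i : {i // m ≤ κ i} => x i 0)
    (h.linearIndependent.comp _ Subtype.val_injective), Multiset.countP_map,
    Fintype.card_subtype]
  rfl

/-- Greedy choice: the next length is the largest `ℓ` for which `V ℓ` is not inside the span `W` so
far. It exists because `V` reaches `⊥`. -/
theorem IsLeadingFiltration.exists_partial_canonicalSet (hV : IsLeadingFiltration F z₀ V) :
    ∀ r ≤ finrank ℂ (V 1), ∃ (κ : Fin r → ℕ) (x : Fin r → ℕ → Fin n → ℂ),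
      (∀ i, IsJordanChain F z₀ (κ i) (x i)) ∧ (LinearIndependent ℂ fun i => x i 0) ∧
      ∀ (i : Fin r) (ℓ : ℕ) (y : ℕ → Fin n → ℂ), IsJordanChain F z₀ ℓ y →
        y 0 ∉ Submodule.span ℂ ((fun j => x j 0) '' {j | j < i}) → ℓ ≤ κ i := by
  intro r
  induction r with
  | zero => exact fun _ => ⟨Fin.elim0, Fin.elim0, fun i => i.elim0, by simp, fun i => i.elim0⟩
  | succ r ih =>
    intro hr
    obtain ⟨κ, x, hc, hli, hmax⟩ := ih (by omega)
    set W := Submodule.span ℂ (Set.range fun i => x i 0) with hW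
    have hWr : finrank ℂ W = r := by simpa using finrank_span_eq_card hli
    obtain ⟨N, hN⟩ := hV.exists_eq_bot
    classical
    let p : ℕ → Prop := fun ℓ => ¬ V ℓ ≤ W
    have h1 : p 1 := fun hle => by
      have := Submodule.finrank_mono hle
      omega
    have hbound : ∀ ℓ, p ℓ → ℓ ≤ N := by
      intro ℓ hℓ
      by_contra! hlt
      exact hℓ ((hV.antitone hlt.le).trans (hN ▸ bot_le))
    set k := Nat.findGreatest p N with hk
    have hpk : p k := Nat.findGreatest_spec (hbound 1 h1) h1
    have hk1 : 1 ≤ k := Nat.le_findGreatest (hbound 1 h1) h1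
    obtain ⟨w, hwV, hwW⟩ := SetLike.not_le_iff_exists.1 hpk
    have hw0 : w ≠ 0 := fun h0 => hwW (h0 ▸ Submodule.zero_mem _)
    obtain ⟨c, hcc, hc0⟩ := (hV.exists_chain_iff k w).2 ⟨hk1, hw0, hwV⟩
    have hlead : (fun i => (Fin.snoc x c : Fin (r + 1) → ℕ → Fin n → ℂ) i 0) =
        Fin.snoc (fun i => x i 0) w := by
      funext i
      refine Fin.lastCases ?_ (fun j => ?_) i <;> simp [hc0]
    refine ⟨Fin.snoc κ k, Fin.snoc x c, fun i => ?_, ?_, fun i => ?_⟩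
    · refine Fin.lastCases ?_ (fun j => ?_) i
      · simpa using hcc
      · simpa using hc j
    · rw [hlead]
      exact linearIndependent_finSnoc.2 ⟨hli, hwW⟩
    · refine Fin.lastCases ?_ (fun j => ?_) i
      · intro ℓ y hy hyn
        rw [Fin.snoc_last]
        have hℓ : p ℓ := fun hle => hyn (by
          have hyW : y 0 ∈ W := hle (hV.mem_of_isJordanChain hy)
          refine Submodule.span_mono ?_ hyW
          rintro _ ⟨j, rfl⟩
          exact ⟨j.castSucc, Fin.castSucc_lt_last j, by simp⟩)
        exact Nat.le_findGreatest (hbound ℓ hℓ) hℓ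
      · intro ℓ y hy hyn
        rw [Fin.snoc_castSucc]
        refine hmax j ℓ y hy fun hmem => hyn ?_
        refine Submodule.span_mono ?_ hmem
        rintro _ ⟨i, hi, rfl⟩
        exact ⟨i.castSucc, Fin.castSucc_lt_castSucc_iff.2 hi, by simp⟩

theorem IsLeadingFiltration.exists_canonicalSet (hV : IsLeadingFiltration F z₀ V) :
    ∃ (r : ℕ) (κ : Fin r → ℕ) (x : Fin r → ℕ → Fin n → ℂ), IsCanonicalSet F z₀ r κ x := by
  obtain ⟨κ, x, hc, hli, hmax⟩ := hV.exists_partial_canonicalSet _ le_rfl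
  refine ⟨_, κ, x, hc, hli, ?_, hmax⟩
  rw [← hV.eq_ker]
  refine Submodule.eq_of_le_of_finrank_eq ?_ (by simpa using finrank_span_eq_card hli)
  rw [Submodule.span_le]
  rintro _ ⟨i, rfl⟩
  exact hV.antitone (hc i).1 (hV.mem_of_isJordanChain (hc i))

theorem IsLengthMultiset.one_le {s : Multiset ℕ} (h : IsLengthMultiset F z₀ s) :
    ∀ k ∈ s, 1 ≤ k := by
  obtain ⟨r, κ, x, hx, rfl⟩ := h
  intro k hk
  obtain ⟨i, -, rfl⟩ := Multiset.mem_map.1 hk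
  exact (hx.chain i).1

theorem IsLengthMultiset.countP_eq_finrank (hV : IsLeadingFiltration F z₀ V) {s : Multiset ℕ}
    (h : IsLengthMultiset F z₀ s) {m : ℕ} (hm : 1 ≤ m) :
    s.countP (m ≤ ·) = finrank ℂ (V m) := by
  obtain ⟨r, κ, x, hx, rfl⟩ := h
  exact hx.countP_eq_finrank hV hm

theorem count_add_countP_succ (s : Multiset ℕ) (m : ℕ) :
    s.count m + s.countP (m + 1 ≤ ·) = s.countP (m ≤ ·) := by
  induction s using Multiset.induction with
  | empty => simp
  | cons a s ih =>
    simp only [Multiset.count_cons, Multiset.countP_cons]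
    split_ifs <;> omega

theorem multiset_eq_of_countP_le {s t : Multiset ℕ} (hs : ∀ k ∈ s, 1 ≤ k)
    (ht : ∀ k ∈ t, 1 ≤ k) (h : ∀ m, 1 ≤ m → s.countP (m ≤ ·) = t.countP (m ≤ ·)) : s = t := by
  ext m
  rcases Nat.eq_zero_or_pos m with rfl | hm
  · rw [Multiset.count_eq_zero_of_notMem fun h0 => absurd (hs 0 h0) (by simp),
      Multiset.count_eq_zero_of_notMem fun h0 => absurd (ht 0 h0) (by simp)]
  · have h1 := count_add_countP_succ s m
    have h2 := count_add_countP_succ t m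
    have h3 := h m hm
    have h4 := h (m + 1) (by omega)
    omega

theorem IsLeadingFiltration.hasJordanStructure (hV : IsLeadingFiltration F z₀ V)
    {s : Multiset ℕ} (hs : ∀ k ∈ s, 1 ≤ k)
    (h : ∀ m, 1 ≤ m → s.countP (m ≤ ·) = finrank ℂ (V m)) : HasJordanStructure F z₀ s := by
  have key : ∀ t, IsLengthMultiset F z₀ t → t = s := fun t ht =>
    multiset_eq_of_countP_le ht.one_le hs fun m hm =>
      (ht.countP_eq_finrank hV hm).trans (h m hm).symm
  refine fun t => ⟨key t, ?_⟩
  rintro rfl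
  obtain ⟨r, κ, x, hx⟩ := hV.exists_canonicalSet
  have hl : IsLengthMultiset F z₀ (Multiset.map κ Finset.univ.val) := ⟨r, κ, x, hx, rfl⟩
  exact key _ hl ▸ hl

theorem IsLeadingFiltration.exists_multiset (hV : IsLeadingFiltration F z₀ V) :
    ∃ s : Multiset ℕ, (∀ k ∈ s, 1 ≤ k) ∧
      ∀ m, 1 ≤ m → s.countP (m ≤ ·) = finrank ℂ (V m) := by
  obtain ⟨r, κ, x, hx⟩ := hV.exists_canonicalSet
  have hl : IsLengthMultiset F z₀ (Multiset.map κ Finset.univ.val) := ⟨r, κ, x, hx, rfl⟩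
  exact ⟨_, hl.one_le, fun m hm => hl.countP_eq_finrank hV hm⟩

end CanonicalSets

/-! ### Substituting a power series of order `d` into polynomials -/

section Substitution

open PowerSeries (constantCoeff)

variable {φ u : ℂ⟦X⟧} {d : ℕ}

theorem constantCoeff_aeval (hφ : constantCoeff φ = 0) (A : Polynomial ℂ) :
    constantCoeff (Polynomial.aeval φ A) = A.coeff 0 := by
  induction A using Polynomial.induction_on' with
  | add p q hp hq => simp [hp, hq]
  | monomial k c =>
    rcases Nat.eq_zero_or_pos k with rfl | hk
    · simp
    · simp [Polynomial.aeval_monomial, hφ, Polynomial.coeff_monomial, hk.ne']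

theorem exists_aeval_eq_X_pow_mul (hd : 1 ≤ d) (hu : IsUnit u) (hφ : φ = PowerSeries.X ^ d * u)
    {A : Polynomial ℂ} (hA : A ≠ 0) :
    ∃ (k : ℕ) (v : ℂ⟦X⟧), IsUnit v ∧ Polynomial.aeval φ A = PowerSeries.X ^ (d * k) * v ∧
      ∀ ℓ, Polynomial.X ^ ℓ ∣ A ↔ ℓ ≤ k := by
  obtain ⟨B, hB, hXB⟩ := Polynomial.exists_eq_pow_rootMultiplicity_mul_and_not_dvd A hA 0
  rw [Polynomial.C_0, sub_zero] at hB hXB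
  have hφ0 : constantCoeff φ = 0 := by
    rw [hφ]
    simp [Nat.one_le_iff_ne_zero.1 hd]
  set k := A.rootMultiplicity 0
  refine ⟨k, u ^ k * Polynomial.aeval φ B, (hu.pow k).mul ?_, ?_, fun ℓ => ?_⟩
  · rw [PowerSeries.isUnit_iff_constantCoeff, constantCoeff_aeval hφ0]
    rw [Polynomial.X_dvd_iff] at hXB
    exact isUnit_iff_ne_zero.2 hXB
  · conv_lhs => rw [hB]
    rw [map_mul, map_pow, Polynomial.aeval_X]
    conv_lhs => enter [1]; rw [hφ]
    ring
  · constructor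
    · intro h
      by_contra! hlt
      rw [hB] at h
      have h' : Polynomial.X ^ k * Polynomial.X ∣ Polynomial.X ^ k * B := by
        rw [← pow_succ]
        exact (pow_dvd_pow _ hlt).trans h
      exact hXB ((mul_dvd_mul_iff_left (pow_ne_zero _ Polynomial.X_ne_zero)).1 h')
    · intro h
      rw [hB]
      exact (pow_dvd_pow _ h).trans (dvd_mul_right _ _)

theorem X_pow_dvd_X_pow_mul_iff {v : ℂ⟦X⟧} (hv : IsUnit v) (m j : ℕ) :
    PowerSeries.X ^ m ∣ PowerSeries.X ^ j * v ↔ m ≤ j := by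
  rw [hv.dvd_mul_right]
  exact pow_dvd_pow_iff PowerSeries.X_ne_zero PowerSeries.X_prime.not_isUnit

theorem X_pow_dvd_aeval_iff (hd : 1 ≤ d) (hu : IsUnit u) (hφ : φ = PowerSeries.X ^ d * u)
    (A : Polynomial ℂ) (m : ℕ) :
    PowerSeries.X ^ m ∣ Polynomial.aeval φ A ↔ Polynomial.X ^ (m ⌈/⌉ d) ∣ A := by
  by_cases hA : A = 0
  · simp [hA]
  obtain ⟨k, v, hv, hAk, hdvd⟩ := exists_aeval_eq_X_pow_mul hd hu hφ hA
  rw [hdvd, hAk, X_pow_dvd_X_pow_mul_iff hv, ceilDiv_le_iff_le_mul hd]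

/-- A nonzero summand has order congruent to `i` modulo `d`, so lowest terms of different summands
cannot cancel. -/
theorem X_pow_dvd_X_pow_mul_aeval (hd : 1 ≤ d) (hu : IsUnit u)
    (hφ : φ = PowerSeries.X ^ d * u) (A : ℕ → Polynomial ℂ) (m : ℕ)
    (h : PowerSeries.X ^ m ∣
      ∑ i ∈ Finset.range d, PowerSeries.X ^ i * Polynomial.aeval φ (A i)) :
    ∀ i < d, PowerSeries.X ^ m ∣ PowerSeries.X ^ i * Polynomial.aeval φ (A i) := by
  induction m with
  | zero => simp
  | succ m ih =>
    have ih := ih ((pow_dvd_pow _ m.le_succ).trans h)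
    -- Only the summand with `i = m % d` can have order exactly `m`; it is then controlled by the
    -- total sum.
    have hne : ∀ i < d, i ≠ m % d →
        PowerSeries.X ^ (m + 1) ∣ PowerSeries.X ^ i * Polynomial.aeval φ (A i) := by
      intro i hi him
      by_cases hA : A i = 0
      · simp [hA]
      obtain ⟨k, v, hv, hAk, -⟩ := exists_aeval_eq_X_pow_mul hd hu hφ hA
      have h1 := ih i hi
      rw [hAk, ← mul_assoc, ← pow_add, X_pow_dvd_X_pow_mul_iff hv] at h1 ⊢
      rcases h1.lt_or_eq with h2 | h2
      · exact h2
      · exact absurd (by rw [h2, Nat.add_mul_mod_self_left, Nat.mod_eq_of_lt hi]) him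
    intro i hi
    by_cases him : i = m % d
    · rw [← Finset.add_sum_erase _ _ (Finset.mem_range.2 hi)] at h
      refine (dvd_add_left (Finset.dvd_sum fun j hj => ?_)).1 h
      rw [Finset.mem_erase, Finset.mem_range] at hj
      exact hne j hj.2 (him ▸ hj.1)
    · exact hne i hi him

/-- The series `X ^ (m % d) * φ ^ (m / d)` has order exactly `m`, so a multiple of it removes the
error term of degree `m`. -/
theorem exists_X_pow_dvd_sub (hd : 1 ≤ d) (hu : IsUnit u) (hφ : φ = PowerSeries.X ^ d * u)
    (w : ℂ⟦X⟧) (m : ℕ) : ∃ A : ℕ → Polynomial ℂ, PowerSeries.X ^ m ∣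
      w - ∑ i ∈ Finset.range d, PowerSeries.X ^ i * Polynomial.aeval φ (A i) := by
  induction m with
  | zero => exact ⟨0, by simp⟩
  | succ m ih =>
    obtain ⟨A, r, hr⟩ := ih
    have hmd : m % d < d := Nat.mod_lt _ hd
    obtain ⟨u', hu'⟩ := hu.exists_right_inv
    set c : ℂ := constantCoeff (r * u' ^ (m / d)) with hc
    refine ⟨Function.update A (m % d)
      (A (m % d) + Polynomial.C c * Polynomial.X ^ (m / d)), ?_⟩
    have hsum : ∑ i ∈ Finset.range d, PowerSeries.X ^ i * Polynomial.aeval φ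
        (Function.update A (m % d) (A (m % d) + Polynomial.C c * Polynomial.X ^ (m / d)) i) =
        ∑ i ∈ Finset.range d, PowerSeries.X ^ i * Polynomial.aeval φ (A i) +
        PowerSeries.X ^ m * (PowerSeries.C c * u ^ (m / d)) := by
      rw [← Finset.add_sum_erase _ _ (Finset.mem_range.2 hmd),
        ← Finset.add_sum_erase (Finset.range d) (fun i => PowerSeries.X ^ i *
          Polynomial.aeval φ (A i)) (Finset.mem_range.2 hmd),
        Finset.sum_congr rfl fun i hi => by
          rw [Function.update_of_ne (Finset.ne_of_mem_erase hi)],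
        Function.update_self, map_add, map_mul, Polynomial.aeval_C, map_pow, Polynomial.aeval_X,
        ← PowerSeries.C_eq_algebraMap]
      have hpow : (PowerSeries.X : ℂ⟦X⟧) ^ m =
          PowerSeries.X ^ (m % d) * (PowerSeries.X ^ d) ^ (m / d) := by
        rw [← pow_mul, ← pow_add, Nat.mod_add_div]
      have hφk : φ ^ (m / d) = (PowerSeries.X ^ d) ^ (m / d) * u ^ (m / d) := by
        rw [hφ, mul_pow]
      rw [hpow, hφk]
      ring
    rw [hsum, ← sub_sub, hr, ← mul_sub, pow_succ]
    refine mul_dvd_mul_left _ ?_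
    rw [PowerSeries.X_dvd_iff, map_sub, map_mul, PowerSeries.constantCoeff_C, hc, map_mul,
      mul_assoc, ← map_mul, ← mul_pow, mul_comm u' u, hu']
    simp

end Substitution

/-! ### Leading vectors modulo powers of `X`, and their behaviour under substitution -/

section LeadingSpaces

variable {n : ℕ}

/-- The values at `0` of the polynomial vectors `v` with `Q v ≡ 0` modulo `X ^ ℓ`. -/
def leadingSpace (Q : Matrix (Fin n) (Fin n) (Polynomial ℂ)) (ℓ : ℕ) :
    Submodule ℂ (Fin n → ℂ) where
  carrier := {x | ∃ v : Fin n → Polynomial ℂ, (fun a => (v a).coeff 0) = x ∧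
    ∀ a, Polynomial.X ^ ℓ ∣ Q.mulVec v a}
  add_mem' := by
    rintro _ _ ⟨v, rfl, hv⟩ ⟨w, rfl, hw⟩
    exact ⟨v + w, by ext; simp, fun a => by
      rw [Matrix.mulVec_add]
      exact dvd_add (hv a) (hw a)⟩
  zero_mem' := ⟨0, by ext; simp, by simp⟩
  smul_mem' := by
    rintro c _ ⟨v, rfl, hv⟩
    exact ⟨Polynomial.C c • v, by ext; simp, fun a => by
      rw [Matrix.mulVec_smul]
      exact (hv a).mul_left _⟩

theorem leadingSpace_antitone (Q : Matrix (Fin n) (Fin n) (Polynomial ℂ)) :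
    Antitone (leadingSpace Q) := by
  rintro k l hkl _ ⟨v, rfl, hv⟩
  exact ⟨v, rfl, fun a => (pow_dvd_pow _ hkl).trans (hv a)⟩

/-- Multiplying by the adjugate gives `X ^ N ∣ det Q * v a`; if `v a` is nonzero at `0`, then `X ^ N
∣ det Q`, impossible once `N` exceeds the degree. -/
theorem leadingSpace_eq_bot {Q : Matrix (Fin n) (Fin n) (Polynomial ℂ)} (hQ : Q.det ≠ 0) :
    ∃ N, leadingSpace Q N = ⊥ := by
  refine ⟨Q.det.natDegree + 1, (Submodule.eq_bot_iff _).2 ?_⟩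
  rintro _ ⟨v, rfl, hv⟩
  ext a
  by_contra ha
  have h1 : Polynomial.X ^ (Q.det.natDegree + 1) ∣ Q.det * v a := by
    have h2 : Q.adjugate.mulVec (Q.mulVec v) a = Q.det * v a := by
      rw [Matrix.mulVec_mulVec, Matrix.adjugate_mul, Matrix.smul_mulVec, Matrix.one_mulVec]
      rfl
    rw [← h2]
    rw [Matrix.mulVec, dotProduct]
    exact Finset.dvd_sum fun b _ => (hv b).mul_left _
  have h3 := Polynomial.prime_X.pow_dvd_of_dvd_mul_right _
    (fun h => ha (Polynomial.X_dvd_iff.1 h)) h1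
  have h4 := Polynomial.natDegree_le_of_dvd h3 hQ
  rw [Polynomial.natDegree_X_pow] at h4
  omega

theorem map_aeval_mulVec (φ : ℂ⟦X⟧) (Q : Matrix (Fin n) (Fin n) (Polynomial ℂ))
    (v : Fin n → Polynomial ℂ) (a : Fin n) :
    (Q.map (Polynomial.aeval φ)).mulVec (fun b => Polynomial.aeval φ (v b)) a =
      Polynomial.aeval φ (Q.mulVec v a) := by
  simp [Matrix.mulVec, dotProduct]

theorem mem_leadingSpace_iff {φ u : ℂ⟦X⟧} {d : ℕ} (hd : 1 ≤ d) (hu : IsUnit u)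
    (hφ : φ = PowerSeries.X ^ d * u) (Q : Matrix (Fin n) (Fin n) (Polynomial ℂ)) {m : ℕ}
    (hm : 1 ≤ m) (x : Fin n → ℂ) :
    x ∈ leadingSpace Q (m ⌈/⌉ d) ↔ ∃ w : Fin n → ℂ⟦X⟧,
      (fun a => PowerSeries.constantCoeff (w a)) = x ∧
      ∀ a, PowerSeries.X ^ m ∣ (Q.map (Polynomial.aeval φ)).mulVec w a := by
  have hφ0 : PowerSeries.constantCoeff φ = 0 := by
    rw [hφ]
    simp [Nat.one_le_iff_ne_zero.1 hd]
  constructor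
  · rintro ⟨v, rfl, hv⟩
    refine ⟨fun b => Polynomial.aeval φ (v b), ?_, fun a => ?_⟩
    · ext a
      rw [constantCoeff_aeval hφ0]
    · rw [map_aeval_mulVec, X_pow_dvd_aeval_iff hd hu hφ]
      exact hv a
  · rintro ⟨w, rfl, hw⟩
    choose A hA using fun a => exists_X_pow_dvd_sub hd hu hφ (w a) m
    -- Only the component `i = 0` contributes to the constant term of `w`.
    refine ⟨fun b => A b 0, ?_, fun a => ?_⟩
    · ext a
      have h1 := (dvd_pow_self _ (Nat.one_le_iff_ne_zero.1 hm)).trans (hA a)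
      rw [PowerSeries.X_dvd_iff, map_sub, map_sum, sub_eq_zero,
        Finset.sum_eq_single_of_mem 0 (Finset.mem_range.2 hd)
          (fun i _ hi => by simp [hi])] at h1
      rw [h1]
      simp [constantCoeff_aeval hφ0]
    · rw [← X_pow_dvd_aeval_iff hd hu hφ]
      have h1 : PowerSeries.X ^ m ∣ ∑ i ∈ Finset.range d,
          PowerSeries.X ^ i * Polynomial.aeval φ (Q.mulVec (fun b => A b i) a) := by
        have h2 : ∑ i ∈ Finset.range d,
            PowerSeries.X ^ i * Polynomial.aeval φ (Q.mulVec (fun b => A b i) a) =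
            (Q.map (Polynomial.aeval φ)).mulVec w a - ∑ b, Polynomial.aeval φ (Q a b) *
              (w b - ∑ i ∈ Finset.range d, PowerSeries.X ^ i * Polynomial.aeval φ (A b i)) := by
          simp only [Matrix.mulVec, dotProduct, Matrix.map_apply, mul_sub,
            Finset.sum_sub_distrib, map_sum, map_mul, Finset.mul_sum, sub_sub_cancel]
          rw [Finset.sum_comm]
          exact Finset.sum_congr rfl fun b _ => Finset.sum_congr rfl fun i _ => by ring
        rw [h2]
        exact dvd_sub (hw a) (Finset.dvd_sum fun b _ => (hA b).mul_left _)
      simpa using X_pow_dvd_X_pow_mul_aeval hd hu hφ _ m h1 0 hd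

end LeadingSpaces

/-! ### Taylor series and Jordan chains as congruences -/

section TaylorSeries

/-- The Taylor series of a function at a point, as a formal power series. -/
noncomputable def taylorSeries (f : ℂ → ℂ) (z₀ : ℂ) : ℂ⟦X⟧ :=
  PowerSeries.mk fun k => iteratedDeriv k f z₀ / (k.factorial : ℂ)

variable {f g : ℂ → ℂ} {z₀ : ℂ}

theorem taylorSeries_congr (h : f =ᶠ[nhds z₀] g) : taylorSeries f z₀ = taylorSeries g z₀ := by
  ext k
  simp [taylorSeries, h.iteratedDeriv_eq k]

theorem taylorSeries_const (c : ℂ) : taylorSeries (fun _ => c) z₀ = PowerSeries.C c := by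
  ext k
  rcases Nat.eq_zero_or_pos k with rfl | hk <;>
    simp [taylorSeries, iteratedDeriv_const, PowerSeries.coeff_C, *, Nat.ne_of_gt]

theorem taylorSeries_add (hf : AnalyticAt ℂ f z₀) (hg : AnalyticAt ℂ g z₀) :
    taylorSeries (fun z => f z + g z) z₀ = taylorSeries f z₀ + taylorSeries g z₀ := by
  ext k
  have := iteratedDeriv_add (n := k) hf.contDiffAt hg.contDiffAt
  simp only [taylorSeries, PowerSeries.coeff_mk, map_add, ← add_div, ← this]
  rfl

theorem taylorSeries_mul (hf : AnalyticAt ℂ f z₀) (hg : AnalyticAt ℂ g z₀) :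
    taylorSeries (fun z => f z * g z) z₀ = taylorSeries f z₀ * taylorSeries g z₀ := by
  ext k
  have h : iteratedDeriv k (fun z => f z * g z) z₀ = _ :=
    iteratedDeriv_mul (n := k) hf.contDiffAt hg.contDiffAt
  rw [PowerSeries.coeff_mul, Finset.Nat.sum_antidiagonal_eq_sum_range_succ_mk]
  simp only [taylorSeries, PowerSeries.coeff_mk, h, Finset.sum_div]
  refine Finset.sum_congr rfl fun i hi => ?_
  have hik : i ≤ k := Nat.lt_succ_iff.1 (Finset.mem_range.1 hi)
  have hc : (k.factorial : ℂ) = k.choose i * i.factorial * (k - i).factorial := by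
    exact_mod_cast (Nat.choose_mul_factorial_mul_factorial hik).symm
  have h1 : (k.choose i : ℂ) ≠ 0 := by exact_mod_cast (Nat.choose_pos hik).ne'
  have h2 : (i.factorial : ℂ) ≠ 0 := by exact_mod_cast i.factorial_ne_zero
  have h3 : ((k - i).factorial : ℂ) ≠ 0 := by exact_mod_cast (k - i).factorial_ne_zero
  rw [hc]
  field_simp

theorem taylorSeries_id : taylorSeries (fun z => z) z₀ = PowerSeries.C z₀ + PowerSeries.X := by
  ext k
  rcases k with _ | _ | k
  · simp [taylorSeries]
  · simp [taylorSeries]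
  · have : deriv (fun z : ℂ => z) = fun _ => 1 := by
      ext
      simp
    simp [taylorSeries, iteratedDeriv_succ', this, PowerSeries.coeff_X,
      iteratedDeriv_const]

theorem taylorSeries_eval (hg : AnalyticAt ℂ g z₀) (q : Polynomial ℂ) :
    taylorSeries (fun z => q.eval (g z)) z₀ = Polynomial.aeval (taylorSeries g z₀) q ∧
      AnalyticAt ℂ (fun z => q.eval (g z)) z₀ := by
  induction q using Polynomial.induction_on with
  | C a => simpa [taylorSeries_const, PowerSeries.C_eq_algebraMap] using analyticAt_const
  | add p q hp hq =>
    simp only [Polynomial.eval_add, map_add]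
    exact ⟨by rw [taylorSeries_add hp.2 hq.2, hp.1, hq.1], hp.2.add hq.2⟩
  | monomial k a h =>
    have hpow : (Polynomial.C a * Polynomial.X ^ (k + 1) : Polynomial ℂ) =
        Polynomial.C a * Polynomial.X ^ k * Polynomial.X := by ring
    rw [hpow]
    generalize (Polynomial.C a * Polynomial.X ^ k : Polynomial ℂ) = p at h
    simp only [Polynomial.eval_mul, map_mul, Polynomial.eval_X, Polynomial.aeval_X]
    exact ⟨by rw [taylorSeries_mul h.2 hg, h.1], h.2.mul hg⟩

theorem exists_taylorSeries_add_inv (hz : z₀ ≠ 0) :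
    ∃ u, IsUnit u ∧ taylorSeries (fun z => z + z⁻¹) z₀ = PowerSeries.C (z₀ + z₀⁻¹) +
      PowerSeries.X ^ (if z₀ = 1 ∨ z₀ = -1 then 2 else 1) * u := by
  have hid : AnalyticAt ℂ (fun z : ℂ => z) z₀ := analyticAt_id
  have hinv : AnalyticAt ℂ (fun z : ℂ => z⁻¹) z₀ := analyticAt_inv hz
  set M := taylorSeries (fun z => z⁻¹) z₀
  have hM : (PowerSeries.C z₀ + PowerSeries.X) * M = 1 := by
    rw [← taylorSeries_id, ← taylorSeries_mul hid hinv, ← map_one PowerSeries.C,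
      ← taylorSeries_const (z₀ := z₀)]
    refine taylorSeries_congr ?_
    filter_upwards [isOpen_ne.mem_nhds hz] with z hz
    exact mul_inv_cancel₀ hz
  have hMu : IsUnit M := IsUnit.of_mul_eq_one_right _ hM
  have hC : (PowerSeries.C z₀ * PowerSeries.C z₀⁻¹ : ℂ⟦X⟧) = 1 := by
    rw [← map_mul, mul_inv_cancel₀ hz, map_one]
  have hsum : taylorSeries (fun z => z + z⁻¹) z₀ = PowerSeries.C z₀ + PowerSeries.X + M := by
    rw [taylorSeries_add hid hinv, taylorSeries_id]
  -- With `z = z₀ + X` and `M = z⁻¹`, this is `z + z⁻¹ - z₀ - z₀⁻¹ = (z - z₀)(z - z₀⁻¹) z⁻¹`; the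
  -- order is `2` exactly when `z₀ = z₀⁻¹`.
  have key : taylorSeries (fun z => z + z⁻¹) z₀ = PowerSeries.C (z₀ + z₀⁻¹) +
      PowerSeries.X * (PowerSeries.X + PowerSeries.C (z₀ - z₀⁻¹)) * M := by
    rw [hsum, map_add, map_sub]
    linear_combination (PowerSeries.C z₀⁻¹ - PowerSeries.X) * hM - M * hC
  by_cases h : z₀ = 1 ∨ z₀ = -1
  · refine ⟨M, hMu, ?_⟩
    have h0 : z₀ - z₀⁻¹ = 0 := by rcases h with rfl | rfl <;> norm_num
    rw [key, if_pos h, h0, map_zero]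
    ring
  · refine ⟨(PowerSeries.X + PowerSeries.C (z₀ - z₀⁻¹)) * M, IsUnit.mul ?_ hMu, ?_⟩
    · rw [PowerSeries.isUnit_iff_constantCoeff, isUnit_iff_ne_zero]
      simp only [map_add, PowerSeries.constantCoeff_X, PowerSeries.constantCoeff_C, zero_add]
      intro h0
      apply h
      have h1 : z₀ * z₀ = 1 := by
        nth_rewrite 2 [sub_eq_zero.1 h0]
        exact mul_inv_cancel₀ hz
      exact mul_self_eq_one_iff.1 h1
    · rw [key, if_neg h]
      ring

variable {n : ℕ}

theorem coeff_mulVec_taylorSeries {F : ℂ → Matrix (Fin n) (Fin n) ℂ}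
    {M : Matrix (Fin n) (Fin n) ℂ⟦X⟧}
    (hM : ∀ a b, taylorSeries (fun z => F z a b) z₀ = M a b) (x : ℕ → Fin n → ℂ) (m : ℕ)
    (a : Fin n) :
    PowerSeries.coeff m (M.mulVec (fun b => PowerSeries.mk fun i => x i b) a) =
      (∑ i ∈ Finset.range (m + 1), (taylorCoeff F z₀ (m - i)).mulVec (x i)) a := by
  simp only [Matrix.mulVec, dotProduct, map_sum, Finset.sum_apply]
  rw [Finset.sum_comm]
  refine Finset.sum_congr rfl fun b _ => ?_
  rw [mul_comm, PowerSeries.coeff_mul, Finset.Nat.sum_antidiagonal_eq_sum_range_succ_mk]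
  refine Finset.sum_congr rfl fun i _ => ?_
  rw [← hM, mul_comm]
  simp [taylorSeries, taylorCoeff]

/-- The chain equations are the vanishing of the first `m` coefficients of `M w`, with `w` the
generating series of the chain. -/
theorem exists_isJordanChain_iff {F : ℂ → Matrix (Fin n) (Fin n) ℂ}
    {M : Matrix (Fin n) (Fin n) ℂ⟦X⟧}
    (hM : ∀ a b, taylorSeries (fun z => F z a b) z₀ = M a b) (m : ℕ) (x : Fin n → ℂ) :
    (∃ y, IsJordanChain F z₀ m y ∧ y 0 = x) ↔ 1 ≤ m ∧ x ≠ 0 ∧ ∃ w : Fin n → ℂ⟦X⟧,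
      (fun a => PowerSeries.constantCoeff (w a)) = x ∧
      ∀ a, PowerSeries.X ^ m ∣ M.mulVec w a := by
  constructor
  · rintro ⟨y, ⟨hm, h0, h⟩, rfl⟩
    refine ⟨hm, h0, fun b => PowerSeries.mk fun i => y i b, ?_, fun a => ?_⟩
    · ext a
      simp [← PowerSeries.coeff_zero_eq_constantCoeff_apply]
    · rw [PowerSeries.X_pow_dvd_iff]
      intro k hk
      rw [coeff_mulVec_taylorSeries hM, h k hk, Pi.zero_apply]
  · rintro ⟨hm, h0, w, rfl, hw⟩
    refine ⟨fun i b => PowerSeries.coeff i (w b), ⟨hm, ?_, fun k hk => ?_⟩, ?_⟩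
    · simpa using h0
    · ext a
      rw [← coeff_mulVec_taylorSeries hM]
      have hmk : (fun b => PowerSeries.mk fun i => PowerSeries.coeff i (w b)) = w := by
        ext
        simp
      rw [hmk]
      exact PowerSeries.X_pow_dvd_iff.1 (hw a) k hk
    · simp

theorem isLeadingFiltration_of_taylorSeries {F : ℂ → Matrix (Fin n) (Fin n) ℂ}
    {Q : Matrix (Fin n) (Fin n) (Polynomial ℂ)} (hQ : Q.det ≠ 0) {φ u : ℂ⟦X⟧} {d : ℕ}
    (hd : 1 ≤ d) (hu : IsUnit u) (hφ : φ = PowerSeries.X ^ d * u)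
    (hF : ∀ a b, taylorSeries (fun z => F z a b) z₀ = Polynomial.aeval φ (Q a b)) :
    IsLeadingFiltration F z₀ fun m => leadingSpace Q (m ⌈/⌉ d) where
  antitone k l hkl := leadingSpace_antitone Q <|
    (ceilDiv_le_iff_le_mul hd).2 (hkl.trans ((ceilDiv_le_iff_le_mul hd).1 le_rfl))
  exists_chain_iff m x := by
    rw [exists_isJordanChain_iff (M := Q.map (Polynomial.aeval φ)) hF]
    refine and_congr_right fun hm => and_congr_right fun _ => ?_
    rw [mem_leadingSpace_iff hd hu hφ Q hm]
  exists_eq_bot := by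
    obtain ⟨N, hN⟩ := leadingSpace_eq_bot hQ
    refine ⟨d * N, ?_⟩
    have : N ≤ (d * N) ⌈/⌉ d := by
      have h := (ceilDiv_le_iff_le_mul (b := d * N) hd).1 le_rfl
      exact le_of_mul_le_mul_left h hd
    exact le_bot_iff.1 ((leadingSpace_antitone Q this).trans hN.le)

end TaylorSeries

/-! ### The change of variable `y = λ + λ⁻¹` -/

section DicksonTransform

open LaurentPolynomial (T C invert)

theorem sum_coeff_eq_eval₂ (p : LaurentPolynomial ℂ) (z : ℂˣ) :
    (p.coeff.sum fun j c => c * (z : ℂ) ^ j) = p.eval₂ (RingHom.id ℂ) z := by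
  induction p using LaurentPolynomial.induction_on' with
  | add p q hp hq =>
    rw [map_add, ← hp, ← hq, AddMonoidAlgebra.coeff_add,
      Finsupp.sum_add_index' (by simp) (by intros; ring)]
  | C_mul_T k a =>
    rw [LaurentPolynomial.eval₂_C_mul_T, ← LaurentPolynomial.single_eq_C_mul_T,
      AddMonoidAlgebra.coeff_single, Finsupp.sum_single_index (by simp)]
    simp

theorem sum_coeff_aeval (q : Polynomial ℂ) {z : ℂ} (hz : z ≠ 0) :
    ((Polynomial.aeval (T 1 + T (-1) : LaurentPolynomial ℂ) q).coeff.sum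
      fun j c => c * z ^ j) = q.eval (z + z⁻¹) := by
  have h := sum_coeff_eq_eval₂ (Polynomial.aeval (T 1 + T (-1)) q) (Units.mk0 z hz)
  rw [Units.val_mk0] at h
  rw [h, Polynomial.aeval_def, Polynomial.hom_eval₂]
  have hc : ((LaurentPolynomial.eval₂ (RingHom.id ℂ) (Units.mk0 z hz)).comp
      (algebraMap ℂ (LaurentPolynomial ℂ))) = RingHom.id ℂ := by
    ext c
    simp
  rw [hc, map_add, LaurentPolynomial.eval₂_T, LaurentPolynomial.eval₂_T]
  simp [Polynomial.eval₂_id]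

theorem exists_add_inv_eq (y : ℂ) : ∃ z : ℂ, z ≠ 0 ∧ z + z⁻¹ = y := by
  -- `y ^ 2 - 4` is the discriminant of `z ^ 2 - y z + 1`, whose two roots are mutually inverse.
  obtain ⟨s, hs⟩ := IsAlgClosed.exists_pow_nat_eq (y ^ 2 - 4) (n := 2) two_pos
  have hz : ((y + s) / 2) * ((y - s) / 2) = 1 := by linear_combination -hs / 4
  refine ⟨(y + s) / 2, left_ne_zero_of_mul_eq_one hz, ?_⟩
  rw [← eq_inv_of_mul_eq_one_right hz]
  ring

theorem aeval_T_add_T_injective :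
    Function.Injective (Polynomial.aeval (T 1 + T (-1) : LaurentPolynomial ℂ) :
      Polynomial ℂ →ₐ[ℂ] LaurentPolynomial ℂ) := by
  intro p q hpq
  refine Polynomial.funext fun y => ?_
  obtain ⟨z, hz, rfl⟩ := exists_add_inv_eq y
  rw [← sum_coeff_aeval p hz, ← sum_coeff_aeval q hz, hpq]

theorem T_add_T_neg_mem_range (k : ℕ) : (T k + T (-k) : LaurentPolynomial ℂ) ∈
    (Polynomial.aeval (R := ℂ) (T 1 + T (-1) : LaurentPolynomial ℂ)).range := by
  refine ⟨Polynomial.dickson 1 1 k, ?_⟩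
  have h := Polynomial.dickson_one_one_eval_add_inv (T 1 : LaurentPolynomial ℂ) (T (-1))
    (by rw [← LaurentPolynomial.T_add]; simp) k
  rw [LaurentPolynomial.T_pow, LaurentPolynomial.T_pow] at h
  rw [← mul_one (k : ℤ), ← mul_neg, ← h]
  change Polynomial.aeval _ _ = _
  rw [Polynomial.aeval_def, ← Polynomial.eval_map, Polynomial.map_dickson, map_one]

theorem add_invert_mem_range (p : LaurentPolynomial ℂ) :
    p + invert p ∈ (Polynomial.aeval (R := ℂ) (T 1 + T (-1) : LaurentPolynomial ℂ)).range := by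
  induction p using LaurentPolynomial.induction_on' with
  | add p q hp hq =>
    rw [map_add, add_add_add_comm]
    exact add_mem hp hq
  | C_mul_T k a =>
    rw [map_mul, LaurentPolynomial.invert_C, LaurentPolynomial.invert_T, ← mul_add,
      ← LaurentPolynomial.smul_eq_C_mul]
    refine Subalgebra.smul_mem _ ?_ a
    obtain ⟨m, rfl | rfl⟩ := k.eq_nat_or_neg
    · exact T_add_T_neg_mem_range m
    · rw [neg_neg, add_comm (T (-(m : ℤ)))]
      exact T_add_T_neg_mem_range m

theorem mem_range_of_coeff_neg {p : LaurentPolynomial ℂ} (hp : ∀ j, p.coeff j = p.coeff (-j)) :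
    p ∈ (Polynomial.aeval (R := ℂ) (T 1 + T (-1) : LaurentPolynomial ℂ)).range := by
  have h1 : invert p = p := by
    ext j
    rw [LaurentPolynomial.invert_apply, hp]
    simp
  -- A palindromic `p` is half of `p + invert p`, a combination of the `T k + T (-k)`, which are
  -- Dickson polynomials in `T 1 + T (-1)`.
  have h2 := Subalgebra.smul_mem _ (add_invert_mem_range p) (2⁻¹ : ℂ)
  rwa [h1, ← two_smul ℂ p, smul_smul, inv_mul_cancel₀ two_ne_zero, one_smul] at h2

variable {n : ℕ} {P : Matrix (Fin n) (Fin n) (LaurentPolynomial ℂ)}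
  {Q : Matrix (Fin n) (Fin n) (Polynomial ℂ)}

theorem existsUnique_isDicksonTransform (hpal : IsPurelyPalindromic P) :
    ∃! Q : Matrix (Fin n) (Fin n) (Polynomial ℂ), IsDicksonTransform P Q := by
  choose Q hQ using fun a b => mem_range_of_coeff_neg (p := P a b)
    fun j => congrFun (congrFun (hpal j) a) b
  refine ⟨Matrix.of Q, Matrix.ext hQ, fun R hR => ?_⟩
  ext1 a b
  apply aeval_T_add_T_injective
  exact (congrFun (congrFun hR a) b).trans (hQ a b).symm

theorem IsDicksonTransform.det_ne_zero (h : IsDicksonTransform P Q) (hreg : IsRegular P) :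
    Q.det ≠ 0 := by
  intro h0
  apply hreg
  rw [← h, ← AlgHom.mapMatrix_apply, ← AlgHom.map_det, h0, map_zero]

theorem IsDicksonTransform.laurentFun_apply (h : IsDicksonTransform P Q) {z : ℂ} (hz : z ≠ 0)
    (a b : Fin n) : laurentFun P z a b = (Q a b).eval (z + z⁻¹) := by
  subst h
  exact sum_coeff_aeval (Q a b) hz

theorem det_map_taylorAlgHom_ne_zero (hQ : Q.det ≠ 0) (y : ℂ) :
    (Q.map (Polynomial.taylorAlgHom y)).det ≠ 0 := by
  rw [← AlgHom.mapMatrix_apply, ← AlgHom.map_det, Polynomial.taylorAlgHom_apply, Ne,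
    Polynomial.taylor_eq_zero]
  exact hQ

theorem aeval_taylor (y : ℂ) (φ : ℂ⟦X⟧) (q : Polynomial ℂ) :
    Polynomial.aeval φ (Polynomial.taylorAlgHom y q) =
      Polynomial.aeval (PowerSeries.C y + φ) q := by
  rw [Polynomial.taylorAlgHom_apply, Polynomial.taylor_apply, Polynomial.aeval_comp]
  simp [add_comm]

theorem isLeadingFiltration_polyFun (hQ : Q.det ≠ 0) (y : ℂ) :
    IsLeadingFiltration (polyFun Q) y
      fun m => leadingSpace (Q.map (Polynomial.taylorAlgHom y)) (m ⌈/⌉ 1) := by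
  refine isLeadingFiltration_of_taylorSeries (φ := PowerSeries.X)
    (det_map_taylorAlgHom_ne_zero hQ y) le_rfl isUnit_one (by simp) fun a b => ?_
  rw [Matrix.map_apply, aeval_taylor, ← taylorSeries_id]
  exact (taylorSeries_eval analyticAt_id (Q a b)).1

theorem IsDicksonTransform.isLeadingFiltration (h : IsDicksonTransform P Q) (hQ : Q.det ≠ 0)
    {z₀ : ℂ} (hz : z₀ ≠ 0) :
    IsLeadingFiltration (laurentFun P) z₀ fun m =>
      leadingSpace (Q.map (Polynomial.taylorAlgHom (z₀ + z₀⁻¹)))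
        (m ⌈/⌉ (if z₀ = 1 ∨ z₀ = -1 then 2 else 1)) := by
  obtain ⟨u, hu, hφ⟩ := exists_taylorSeries_add_inv hz
  refine isLeadingFiltration_of_taylorSeries (det_map_taylorAlgHom_ne_zero hQ _)
    (by split_ifs <;> simp) hu rfl fun a b => ?_
  have hg : AnalyticAt ℂ (fun z : ℂ => z + z⁻¹) z₀ := analyticAt_id.add (analyticAt_inv hz)
  rw [Matrix.map_apply, aeval_taylor, ← hφ, ← (taylorSeries_eval hg (Q a b)).1]
  refine taylorSeries_congr ?_
  filter_upwards [isOpen_ne.mem_nhds hz] with z hz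
  exact h.laurentFun_apply hz a b

theorem countP_map_two_mul (s : Multiset ℕ) (m : ℕ) :
    (s.map fun ℓ => 2 * ℓ).countP (m ≤ ·) = s.countP (m ⌈/⌉ 2 ≤ ·) := by
  rw [Multiset.countP_map, Multiset.countP_eq_card_filter]
  simp only [ceilDiv_le_iff_le_mul (two_pos : 0 < 2)]

end DicksonTransform

end Palindromic

theorem mainTheorem6 (n : ℕ) (P : Matrix (Fin n) (Fin n) (LaurentPolynomial ℂ))
    (hreg : Palindromic.IsRegular P) (hpal : Palindromic.IsPurelyPalindromic P) :
    (∃! Q : Matrix (Fin n) (Fin n) (Polynomial ℂ), Palindromic.IsDicksonTransform P Q) ∧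
    ∀ Q : Matrix (Fin n) (Fin n) (Polynomial ℂ), Palindromic.IsDicksonTransform P Q →
      (∀ z₀ : ℂ, z₀ ≠ 0 → z₀ ≠ 1 → z₀ ≠ -1 → ∃ s : Multiset ℕ,
        Palindromic.HasJordanStructure (Palindromic.polyFun Q) (z₀ + z₀⁻¹) s ∧
        Palindromic.HasJordanStructure (Palindromic.laurentFun P) z₀ s ∧
        Palindromic.HasJordanStructure (Palindromic.laurentFun P) z₀⁻¹ s) ∧
      (∀ z₀ : ℂ, z₀ = 1 ∨ z₀ = -1 →
        (∀ ℓ : ℕ,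
          (∃ x, Palindromic.IsJordanChain (Palindromic.polyFun Q) (z₀ + z₀⁻¹) ℓ x) ↔
          (∃ x, Palindromic.IsJordanChain (Palindromic.laurentFun P) z₀ (2 * ℓ) x)) ∧
        ∃ s : Multiset ℕ,
          Palindromic.HasJordanStructure (Palindromic.polyFun Q) (z₀ + z₀⁻¹) s ∧
          Palindromic.HasJordanStructure (Palindromic.laurentFun P) z₀
            (s.map fun ℓ => 2 * ℓ)) := by
  refine ⟨Palindromic.existsUnique_isDicksonTransform hpal, fun Q hPQ => ?_⟩
  have hQ := hPQ.det_ne_zero hreg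
  refine ⟨fun z₀ hz h1 h2 => ?_, fun z₀ h12 => ?_⟩
  · have hV := Palindromic.isLeadingFiltration_polyFun hQ (z₀ + z₀⁻¹)
    obtain ⟨s, hs, hcount⟩ := hV.exists_multiset
    have hP := hPQ.isLeadingFiltration hQ hz
    have hP' := hPQ.isLeadingFiltration hQ (inv_ne_zero hz)
    rw [if_neg (by tauto)] at hP
    rw [if_neg (by simp [inv_eq_iff_eq_inv, h1, h2]), inv_inv, add_comm z₀⁻¹] at hP'
    exact ⟨s, hV.hasJordanStructure hs hcount, hP.hasJordanStructure hs hcount,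
      hP'.hasJordanStructure hs hcount⟩
  · have hz : z₀ ≠ 0 := by rcases h12 with rfl | rfl <;> simp
    have hV := Palindromic.isLeadingFiltration_polyFun hQ (z₀ + z₀⁻¹)
    have hP := hPQ.isLeadingFiltration hQ hz
    rw [if_pos h12] at hP
    simp only [ceilDiv_one] at hV
    have hceil : ∀ ℓ : ℕ, (2 * ℓ) ⌈/⌉ 2 = ℓ := fun ℓ => by
      rw [Nat.ceilDiv_eq_add_pred_div]
      omega
    constructor
    · intro ℓ
      constructor
      · rintro ⟨x, hx⟩
        obtain ⟨hℓ, hx0, hxV⟩ := (hV.exists_chain_iff ℓ (x 0)).1 ⟨x, hx, rfl⟩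
        obtain ⟨y, hy, -⟩ := (hP.exists_chain_iff (2 * ℓ) (x 0)).2
          ⟨by omega, hx0, by rwa [hceil]⟩
        exact ⟨y, hy⟩
      · rintro ⟨x, hx⟩
        obtain ⟨hℓ, hx0, hxV⟩ := (hP.exists_chain_iff (2 * ℓ) (x 0)).1 ⟨x, hx, rfl⟩
        rw [hceil] at hxV
        obtain ⟨y, hy, -⟩ := (hV.exists_chain_iff ℓ (x 0)).2 ⟨by omega, hx0, hxV⟩
        exact ⟨y, hy⟩
    · obtain ⟨s, hs, hcount⟩ := hV.exists_multiset
      refine ⟨s, hV.hasJordanStructure hs hcount, hP.hasJordanStructure ?_ fun m hm => ?_⟩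
      · intro k hk
        obtain ⟨l, hl, rfl⟩ := Multiset.mem_map.1 hk
        have := hs l hl
        omega
      -- `2 * ℓ ≥ m` means `ℓ ≥ ⌈m / 2⌉`, matching the index of the filtration of `P`; `⌈m / 2⌉ ≥ 1`
      -- since `m ≥ 1`.
      · rw [Palindromic.countP_map_two_mul, hcount]
        rw [Nat.ceilDiv_eq_add_pred_div]
        omega
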